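/- Let $\mathbb K=\mathbb R$ or $\mathbb C$, let $n\ge 0$ be an integer, $E$ a Banach space over $\mathbb K$ and $\mathfrak U$ an ultrafilter on a set $I$. The ultrapower $(E)_{\mathfrak U}$ is the Banach space of bounded families $(z_i)_{i\in I}$ in $E$, where two families are identified if $\lim_{i,\mathfrak U}\|z_i-y_i\|=0$, with the norm $\|(z_i)_{\mathfrak U}\|=\lim_{i,\mathfrak U}\|z_i\|$. Let $\mathcal P^n(E)$ be the space of continuous $n$-homogeneous polynomials $P:E\to\mathbb K$, that is $P(x)=A(x,\dots,x)$ with a (unique) continuous symmetric $n$-linear form $A$ on $E$. The iterated extension of $P$ to $(E)_{\mathfrak U}$ is $$\overline P\big((z_i)_{\mathfrak U}\big)=\lim_{i_1,\mathfrak U}\cdots\lim_{i_n,\mathfrak U}A(z_{i_1},\dots,z_{i_n}).$$ Let $\otimes^{n,s}E$ be the span of the tensors $\otimes^n x$ ($x\in E$) in $\otimes^n E$. An s-tensor norm $\alpha$ of order $n$ assigns to each Banach space $E$ a norm $\alpha(\cdot\,;\otimes^{n,s}E)$ on $\otimes^{n,s}E$ such that $\varepsilon_s\le\alpha\le\pi_s$,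 where $\varepsilon_s(z)=\sup\{|\langle\varphi^n,z\rangle|:\varphi\in E',\|\varphi\|\le1\}$ and $\pi_s(z)=\inf\{\sum_j|c_j|\|x_j\|^n: z=\sum_j c_j\otimes^n x_j\}$, and such that $\alpha((\otimes^{n,s}T)z;\otimes^{n,s}F)\le\|T\|^n\alpha(z;\otimes^{n,s}E)$ for all bounded operators $T:E\to F$ between Banach spaces and all $z\in\otimes^{n,s}E$. It is finitely generated if $\alpha(z;\otimes^{n,s}E)=\inf\{\alpha(z;\otimes^{n,s}M): M\subset E \text{ a finite dimensional subspace},\ z\in\otimes^{n,s}M\}$ for all $E$ and all $z\in\otimes^{n,s}E$. Let $\widetilde\otimes^{n,s}_\alpha E$ be the completion of $\otimes^{n,s}E$ under $\alpha$. A functional $\varphi\in(\widetilde\otimes^{n,s}_\alpha E)'$ is identified with the polynomial $P(x)=\varphi(\otimes^n x)$, and the norm of $P$ in $(\widetilde\otimes^{n,s}_\alpha E)'$ is $\|\varphi\|$. A Banach ideal of $n$-homogeneous polynomials $(\mathcal Q,\|\cdot\|_{\mathcal Q})$ assigns to each Banach space $E$ a linear subspace $\mathcal Q(E)\subset\mathcal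 P^n(E)$ with a complete norm $\|\cdot\|_{\mathcal Q(E)}$ such that (i) $P\circ T\in\mathcal Q(E_1)$ and $\|P\circ T\|_{\mathcal Q(E_1)}\le\|P\|_{\mathcal Q(E)}\|T\|^n$ for all $P\in\mathcal Q(E)$ and all bounded operators $T:E_1\to E$, and (ii) the polynomial $z\mapsto z^n$ belongs to $\mathcal Q(\mathbb K)$ and has norm $1$. It is maximal if for each Banach space $E$ a polynomial $P\in\mathcal P^n(E)$ belongs to $\mathcal Q(E)$ exactly when $\sup_M\|P|_M\|_{\mathcal Q(M)}<\infty$, where $M$ runs over the finite dimensional subspaces of $E$, and $\|P\|_{\mathcal Q(E)}$ is then equal to this supremum. **Theorem.** (a) If $\alpha$ is a finitely generated s-tensor norm of order $n$ and $P\in(\widetilde\otimes^{n,s}_\alpha E)'$, then $\overline P\in(\widetilde\otimes^{n,s}_\alpha(E)_{\mathfrak U})'$ and $$\|P\|_{(\widetilde\otimes^{n,s}_\alpha E)'}=\|\overline P\|_{(\widetilde\otimes^{n,s}_\alpha(E)_{\mathfrak U})'}.$$ (b) If $\mathcal Q$ is a maximal Banach ideal of $n$-homogeneous polynomials and $P\in\mathcal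 Q(E)$, then $\overline P\in\mathcal Q((E)_{\mathfrak U})$ and $$\|P\|_{\mathcal Q(E)}=\|\overline P\|_{\mathcal Q((E)_{\mathfrak U})}.$$ -/

import Mathlib

open Filter Topology
open scoped ENNReal TensorProduct

universe u

noncomputable section

namespace PolyExt

/-! ### Continuous homogeneous polynomials -/

section Polynomials

variable (𝕜 : Type) [RCLike 𝕜] (n : ℕ)
variable (E : Type u) [NormedAddCommGroup E] [NormedSpace 𝕜 E]

/-- The space of continuous scalar valued `n`-homogeneous polynomials on `E`: the diagonals
`x ↦ A (x, …, x)` of continuous symmetric `n`-linear forms `A`. -/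
def HomPoly : Submodule 𝕜 (E → 𝕜) where
  carrier := {P | ∃ A : ContinuousMultilinearMap 𝕜 (fun _ : Fin n => E) 𝕜,
    (∀ (σ : Equiv.Perm (Fin n)) (v : Fin n → E), A (v ∘ σ) = A v) ∧
      ∀ x, P x = A (fun _ => x)}
  add_mem' := by
    rintro P Q ⟨A, hA, hP⟩ ⟨B, hB, hQ⟩
    exact ⟨A + B, fun σ v => by simp [hA σ v, hB σ v], fun x => by simp [hP x, hQ x]⟩
  zero_mem' := ⟨0, fun _ _ => by simp, fun _ => by simp⟩
  smul_mem' := by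
    rintro c P ⟨A, hA, hP⟩
    exact ⟨c • A, fun σ v => by simp [hA σ v], fun x => by simp [hP x]⟩

variable {𝕜 n E}

/-- The symmetric continuous `n`-linear form associated with a polynomial (it is unique, by the
polarization formula). -/
def HomPoly.assoc (P : HomPoly 𝕜 n E) : ContinuousMultilinearMap 𝕜 (fun _ : Fin n => E) 𝕜 :=
  P.2.choose

theorem HomPoly.assoc_symm (P : HomPoly 𝕜 n E) (σ : Equiv.Perm (Fin n)) (v : Fin n → E) :
    HomPoly.assoc P (v ∘ σ) = HomPoly.assoc P v :=
  P.2.choose_spec.1 σ v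

theorem HomPoly.assoc_diag (P : HomPoly 𝕜 n E) (x : E) : P.1 x = HomPoly.assoc P (fun _ => x) :=
  P.2.choose_spec.2 x

end Polynomials

/-! ### Ultrapowers -/

section Ultrapower

variable (𝕜 : Type) [RCLike 𝕜] {I : Type u} (U : Ultrafilter I)
variable (E : Type u) [NormedAddCommGroup E] [NormedSpace 𝕜 E]

/-- The bounded families `(z_i)` in `E` with `lim_{i, U} ‖z_i‖ = 0`. -/
def nullFamilies : Submodule 𝕜 (lp (fun _ : I => E) ∞) where
  carrier := {z | Tendsto (fun i => ‖z i‖) U (𝓝 0)}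
  add_mem' := by
    intro a b ha hb
    refine squeeze_zero (fun _ => norm_nonneg _) (fun i => norm_add_le (a i) (b i)) ?_
    simpa using ha.add hb
  zero_mem' := by simp
  smul_mem' := by
    intro c a ha
    simpa [norm_smul] using ha.const_mul ‖c‖

instance isClosed_nullFamilies :
    IsClosed ((nullFamilies 𝕜 U E : Submodule 𝕜 (lp (fun _ : I => E) ∞)) :
      Set (lp (fun _ : I => E) ∞)) := by
  rw [← isSeqClosed_iff_isClosed]
  intro a z ha hz
  change Tendsto (fun i => ‖z i‖) U (𝓝 0)
  rw [Metric.tendsto_nhds]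
  intro ε hε
  obtain ⟨k, hk⟩ := (Metric.tendsto_atTop.1 hz (ε / 2) (half_pos hε))
  have h1 := hk k le_rfl
  have h2 : Tendsto (fun i => ‖a k i‖) U (𝓝 0) := ha k
  filter_upwards [(Metric.tendsto_nhds.1 h2) (ε / 2) (half_pos hε)] with i hi
  have h3 : ‖(z - a k) i‖ ≤ ‖z - a k‖ := lp.norm_apply_le_norm (by simp) _ i
  have h4 : ‖z i‖ ≤ ‖(z - a k) i‖ + ‖a k i‖ := by
    simpa using norm_add_le ((z - a k) i) (a k i)
  rw [dist_comm, dist_eq_norm] at h1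
  simp only [dist_zero_right, norm_norm] at hi ⊢
  linarith

/-- The ultrapower `(E)_U`: bounded families modulo the families that tend to `0` along `U`.
Its norm, the quotient norm of `ℓ^∞(I, E)`, is `lim_{i, U} ‖z_i‖`, see `Ultrapower.tendsto_norm`. -/
def Ultrapower : Type u := lp (fun _ : I => E) ∞ ⧸ nullFamilies 𝕜 U E

instance : NormedAddCommGroup (Ultrapower 𝕜 U E) :=
  inferInstanceAs (NormedAddCommGroup (lp (fun _ : I => E) ∞ ⧸ nullFamilies 𝕜 U E))

instance : NormedSpace 𝕜 (Ultrapower 𝕜 U E) :=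
  inferInstanceAs (NormedSpace 𝕜 (lp (fun _ : I => E) ∞ ⧸ nullFamilies 𝕜 U E))

instance [CompleteSpace E] : CompleteSpace (Ultrapower 𝕜 U E) :=
  inferInstanceAs (CompleteSpace (lp (fun _ : I => E) ∞ ⧸ nullFamilies 𝕜 U E))

variable {E}

/-- The class `(z_i)_U` of a bounded family. -/
def Ultrapower.mk : lp (fun _ : I => E) ∞ →ₗ[𝕜] Ultrapower 𝕜 U E := (nullFamilies 𝕜 U E).mkQ

variable {𝕜 U}

theorem Ultrapower.mk_surjective :
    Function.Surjective (Ultrapower.mk 𝕜 U : lp (fun _ : I => E) ∞ →ₗ[𝕜] Ultrapower 𝕜 U E) :=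
  (nullFamilies 𝕜 U E).mkQ_surjective

theorem Ultrapower.mk_eq_mk_iff (z y : lp (fun _ : I => E) ∞) :
    Ultrapower.mk 𝕜 U z = Ultrapower.mk 𝕜 U y ↔ Tendsto (fun i => ‖z i - y i‖) U (𝓝 0) :=
  Submodule.Quotient.eq _

/-- A chosen representing family of an element of the ultrapower. -/
def Ultrapower.rep (z : Ultrapower 𝕜 U E) : lp (fun _ : I => E) ∞ :=
  Function.surjInv Ultrapower.mk_surjective z

theorem Ultrapower.mk_rep (z : Ultrapower 𝕜 U E) : Ultrapower.mk 𝕜 U z.rep = z :=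
  Function.surjInv_eq _ z

/-- The norm of the ultrapower is `‖(z_i)_U‖ = lim_{i, U} ‖z_i‖`. -/
theorem Ultrapower.tendsto_norm (z : lp (fun _ : I => E) ∞) :
    Tendsto (fun i => ‖z i‖) U (𝓝 ‖Ultrapower.mk 𝕜 U z‖) := by
  classical
  obtain ⟨L, -, hL⟩ := (isCompact_Icc (a := (0 : ℝ)) (b := ‖z‖)).ultrafilter_le_nhds
    (U.map fun i => ‖z i‖) (by
      rw [le_principal_iff]
      exact Filter.mem_map.2 (Filter.univ_mem' fun i =>
        ⟨norm_nonneg _, lp.norm_apply_le_norm (by simp) z i⟩))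
  replace hL : Tendsto (fun i => ‖z i‖) U (𝓝 L) := hL
  have hL0 : 0 ≤ L := ge_of_tendsto' hL fun _ => norm_nonneg _
  suffices h : ‖Ultrapower.mk 𝕜 U z‖ = L by rwa [h]
  apply le_antisymm
  · refine le_of_forall_pos_le_add fun ε hε => ?_
    have hS : ∀ᶠ i in (U : Filter I), ‖z i‖ < L + ε := hL.eventually_lt_const (by linarith)
    let w : I → E := fun i => if ‖z i‖ < L + ε then z i else 0
    have hw : ∀ i, ‖w i‖ ≤ L + ε := by
      intro i
      by_cases h : ‖z i‖ < L + ε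
      · simp only [w, if_pos h]; exact h.le
      · simp only [w, if_neg h, norm_zero]; linarith
    let w' : lp (fun _ : I => E) ∞ :=
      ⟨w, memℓp_infty ⟨L + ε, by rintro _ ⟨i, rfl⟩; exact hw i⟩⟩
    have h1 : Ultrapower.mk 𝕜 U z = Ultrapower.mk 𝕜 U w' := by
      rw [Ultrapower.mk_eq_mk_iff]
      refine tendsto_const_nhds.congr' ?_
      filter_upwards [hS] with i hi
      simp [w', w, hi]
    rw [h1]
    exact (Submodule.Quotient.norm_mk_le _ _).trans
      (lp.norm_le_of_forall_le (by linarith) hw)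
  · refine le_of_forall_pos_le_add fun ε hε => ?_
    obtain ⟨w, hw, hwn⟩ : ∃ w, Ultrapower.mk 𝕜 U w = Ultrapower.mk 𝕜 U z ∧
        ‖w‖ < ‖Ultrapower.mk 𝕜 U z‖ + ε :=
      Submodule.Quotient.norm_mk_lt (S := nullFamilies 𝕜 U E) (Ultrapower.mk 𝕜 U z) hε
    have h1 : Tendsto (fun i => ‖z i - w i‖) U (𝓝 0) :=
      (Ultrapower.mk_eq_mk_iff z w).1 hw.symm
    have h2 : Tendsto (fun i => ‖z i‖ - ‖z i - w i‖) U (𝓝 (L - 0)) := hL.sub h1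
    rw [sub_zero] at h2
    refine (le_of_tendsto' h2 fun i => ?_).trans hwn.le
    have h3 : ‖w i‖ ≤ ‖w‖ := lp.norm_apply_le_norm (by simp) w i
    have h4 := norm_sub_norm_le (z i) (w i)
    linarith [norm_sub_norm_le (z i) (z i - w i), norm_sub_le (z i) (z i - w i),
      show ‖z i‖ ≤ ‖z i - w i‖ + ‖w i‖ by simpa using norm_add_le (z i - w i) (w i)]

end Ultrapower

/-! ### Iterated limits and the iterated extension -/

section Iterated

variable {𝕜 : Type} [RCLike 𝕜] {I : Type u} (U : Ultrafilter I)

/-- The iterated limit `lim_{i₁, U} ⋯ lim_{iₙ, U} f (i₁, …, iₙ)`. -/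
def iterLim : (n : ℕ) → ((Fin n → I) → 𝕜) → 𝕜
  | 0, f => f Fin.elim0
  | n + 1, f => limUnder (U : Filter I) fun i => iterLim n fun k => f (Fin.cons i k)

theorem tendsto_limUnder_of_bounded (g : I → 𝕜) (C : ℝ) (hg : ∀ i, ‖g i‖ ≤ C) :
    Tendsto g U (𝓝 (limUnder (U : Filter I) g)) := by
  obtain ⟨L, -, hL⟩ := (isCompact_closedBall (0 : 𝕜) C).ultrafilter_le_nhds (U.map g) (by
    rw [le_principal_iff]
    exact Filter.mem_map.2 (Filter.univ_mem' fun i => by simpa using hg i))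
  exact tendsto_nhds_limUnder ⟨L, hL⟩

theorem norm_iterLim_le (n : ℕ) (f : (Fin n → I) → 𝕜) (C : ℝ) (hf : ∀ k, ‖f k‖ ≤ C) :
    ‖iterLim U n f‖ ≤ C := by
  induction n with
  | zero => exact hf _
  | succ n ih =>
    have h : ∀ i, ‖iterLim U n fun k => f (Fin.cons i k)‖ ≤ C := fun i => ih _ fun k => hf _
    exact le_of_tendsto' (tendsto_limUnder_of_bounded U _ C h).norm h

/-- For a bounded family all the limits in `iterLim` exist. -/
theorem tendsto_iterLim (n : ℕ) (f : (Fin (n + 1) → I) → 𝕜) (C : ℝ) (hf : ∀ k, ‖f k‖ ≤ C) :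
    Tendsto (fun i => iterLim U n fun k => f (Fin.cons i k)) U (𝓝 (iterLim U (n + 1) f)) :=
  tendsto_limUnder_of_bounded U _ C fun _ => norm_iterLim_le U n _ C fun _ => hf _

theorem norm_iterLim_sub_le (n : ℕ) (f g : (Fin n → I) → 𝕜) (C c : ℝ) (d : Fin n → I → ℝ)
    (hf : ∀ k, ‖f k‖ ≤ C) (hg : ∀ k, ‖g k‖ ≤ C) (hd : ∀ j, Tendsto (d j) U (𝓝 0))
    (hfg : ∀ k, ‖f k - g k‖ ≤ c + ∑ j, d j (k j)) :
    ‖iterLim U n f - iterLim U n g‖ ≤ c := by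
  induction n generalizing c with
  | zero => simpa [iterLim] using hfg Fin.elim0
  | succ n ih =>
    have h1 := ((tendsto_iterLim U n f C hf).sub (tendsto_iterLim U n g C hg)).norm
    have h2 : Tendsto (fun i => c + d 0 i) U (𝓝 (c + 0)) := (hd 0).const_add c
    rw [add_zero] at h2
    refine le_of_tendsto_of_tendsto' h1 h2 fun i => ?_
    refine ih _ _ (c + d 0 i) (fun j => d j.succ) (fun _ => hf _) (fun _ => hg _)
      (fun j => hd j.succ) fun k => ?_
    have := hfg (Fin.cons i k)
    rw [Fin.sum_univ_succ] at this
    simpa [add_assoc] using this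

variable {U} {n : ℕ} {E : Type u} [NormedAddCommGroup E] [NormedSpace 𝕜 E]

/-- The iterated extension of a continuous `n`-linear form to the ultrapower,
`(z₁, …, zₙ) ↦ lim_{i₁, U} ⋯ lim_{iₙ, U} A (z_{i₁}^{(1)}, …, z_{iₙ}^{(n)})`. The value does not
depend on the representing families, see `iterExtMultilinear_mk`. -/
def iterExtMultilinear (A : ContinuousMultilinearMap 𝕜 (fun _ : Fin n => E) 𝕜)
    (z : Fin n → Ultrapower 𝕜 U E) : 𝕜 :=
  iterLim U n fun i => A fun j => (z j).rep (i j)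

theorem iterExtMultilinear_mk (A : ContinuousMultilinearMap 𝕜 (fun _ : Fin n => E) 𝕜)
    (w : Fin n → lp (fun _ : I => E) ∞) :
    iterExtMultilinear A (fun j => Ultrapower.mk 𝕜 U (w j)) =
      iterLim U n fun i => A fun j => w j (i j) := by
  set v : Fin n → lp (fun _ : I => E) ∞ := fun j => (Ultrapower.mk 𝕜 U (w j)).rep with hv
  set B : ℝ := max ‖v‖ ‖w‖ with hB
  have hb : ∀ (a : Fin n → lp (fun _ : I => E) ∞) (i : Fin n → I),
      ‖fun j => a j (i j)‖ ≤ ‖a‖ := fun a i =>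
    (pi_norm_le_iff_of_nonneg (norm_nonneg _)).2 fun j =>
      (lp.norm_apply_le_norm (by simp) (a j) (i j)).trans (norm_le_pi_norm a j)
  have hbound : ∀ (a : Fin n → lp (fun _ : I => E) ∞), ‖a‖ ≤ B → ∀ i : Fin n → I,
      ‖A fun j => a j (i j)‖ ≤ ‖A‖ * B ^ n := by
    intro a ha i
    simpa using A.le_opNorm_mul_pow_of_le ((hb a i).trans ha)
  have hd : ∀ j, Tendsto (fun i => ‖v j i - w j i‖) U (𝓝 0) := fun j =>
    (Ultrapower.mk_eq_mk_iff (𝕜 := 𝕜) (v j) (w j)).1 (Ultrapower.mk_rep _)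
  have key := norm_iterLim_sub_le U n (fun i => A fun j => v j (i j))
    (fun i => A fun j => w j (i j)) (‖A‖ * B ^ n) 0
    (fun j i => ‖A‖ * n * B ^ (n - 1) * ‖v j i - w j i‖)
    (hbound v (le_max_left _ _)) (hbound w (le_max_right _ _))
    (fun j => by simpa using (hd j).const_mul (‖A‖ * n * B ^ (n - 1))) (fun i => by
      have h1 := A.norm_image_sub_le (fun j => v j (i j)) (fun j => w j (i j))
      rw [Fintype.card_fin] at h1
      rw [zero_add, ← Finset.mul_sum]
      refine h1.trans ?_
      have hB0 : 0 ≤ B := (norm_nonneg v).trans (le_max_left _ _)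
      have h2 : max ‖fun j => v j (i j)‖ ‖fun j => w j (i j)‖ ≤ B :=
        max_le_max (hb v i) (hb w i)
      have h3 : ‖(fun j => v j (i j)) - fun j => w j (i j)‖ ≤ ∑ j, ‖v j (i j) - w j (i j)‖ :=
        (pi_norm_le_iff_of_nonneg (Finset.sum_nonneg fun _ _ => norm_nonneg _)).2 fun j =>
          Finset.single_le_sum (f := fun j => ‖v j (i j) - w j (i j)‖)
            (fun _ _ => norm_nonneg _) (Finset.mem_univ j)
      gcongr)
  exact sub_eq_zero.1 (norm_le_zero_iff.1 key)

/-- The iterated extension `P̄` of a continuous homogeneous polynomial to the ultrapower. -/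
def iterExt (U : Ultrafilter I) (P : HomPoly 𝕜 n E) : Ultrapower 𝕜 U E → 𝕜 :=
  fun z => iterExtMultilinear (HomPoly.assoc P) fun _ => z

end Iterated

/-! ### Symmetric tensor products and s-tensor norms -/

section Tensor

variable (𝕜 : Type) [RCLike 𝕜] (n : ℕ)

section Space

variable (E : Type u) [NormedAddCommGroup E] [NormedSpace 𝕜 E]

/-- The `n`-fold symmetric tensor product `⊗^{n,s} E`: the span of the powers `⊗ⁿ x` in `⊗ⁿ E`. -/
def SymTensor : Submodule 𝕜 (⨂[𝕜] _ : Fin n, E) :=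
  Submodule.span 𝕜 (Set.range fun x : E => PiTensorProduct.tprod 𝕜 fun _ : Fin n => x)

variable {E}

/-- The power `⊗ⁿ x`. -/
def symPow (x : E) : SymTensor 𝕜 n E :=
  ⟨PiTensorProduct.tprod 𝕜 fun _ : Fin n => x, Submodule.subset_span ⟨x, rfl⟩⟩

variable {𝕜 n}

/-- The induced map `⊗^{n,s} T : ⊗^{n,s} E → ⊗^{n,s} F`. -/
def SymTensor.map {F : Type u} [NormedAddCommGroup F] [NormedSpace 𝕜 F] (T : E →L[𝕜] F) :
    SymTensor 𝕜 n E →ₗ[𝕜] SymTensor 𝕜 n F :=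
  (PiTensorProduct.map fun _ : Fin n => (T : E →ₗ[𝕜] F)).restrict (by
    intro z hz
    induction hz using Submodule.span_induction with
    | mem z hz =>
      obtain ⟨x, rfl⟩ := hz
      rw [PiTensorProduct.map_tprod]
      exact (symPow 𝕜 n (T x)).2
    | zero => simp
    | add a b _ _ ha hb => rw [map_add]; exact add_mem ha hb
    | smul c a _ ha => rw [map_smul]; exact Submodule.smul_mem _ c ha)

/-- The value `⟨φⁿ, z⟩` of the linear functional with `⊗ⁿ x ↦ φ(x)ⁿ`. -/
def powPairing (φ : StrongDual 𝕜 E) (z : SymTensor 𝕜 n E) : 𝕜 :=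
  PiTensorProduct.lift ((MultilinearMap.mkPiAlgebra 𝕜 (Fin n) 𝕜).compLinearMap
    fun _ : Fin n => (φ : E →ₗ[𝕜] 𝕜)) z.1

/-- The injective s-tensor norm `ε_s (z) = sup {|⟨φⁿ, z⟩| : ‖φ‖ ≤ 1}`. -/
def epsNorm (z : SymTensor 𝕜 n E) : ℝ :=
  sSup {r | ∃ φ : StrongDual 𝕜 E, ‖φ‖ ≤ 1 ∧ r = ‖powPairing φ z‖}

/-- The projective s-tensor norm
`π_s (z) = inf {∑ |c_j| ‖x_j‖ⁿ : z = ∑ c_j ⊗ⁿ x_j}`. -/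
def piNorm (z : SymTensor 𝕜 n E) : ℝ :=
  sInf {r | ∃ (m : ℕ) (c : Fin m → 𝕜) (x : Fin m → E),
    z = ∑ j, c j • symPow 𝕜 n (x j) ∧ r = ∑ j, ‖c j‖ * ‖x j‖ ^ n}

end Space

/-- An s-tensor norm of order `n`: a norm on `⊗^{n,s} E` for each Banach space `E`, with
`ε_s ≤ α ≤ π_s` and the metric mapping property. -/
structure STensorNorm where
  /-- the norm `α(·; ⊗^{n,s} E)` -/
  nrm : ∀ (E : Type u) [NormedAddCommGroup E] [NormedSpace 𝕜 E] [CompleteSpace E],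
    Seminorm 𝕜 (SymTensor 𝕜 n E)
  eq_zero : ∀ (E : Type u) [NormedAddCommGroup E] [NormedSpace 𝕜 E] [CompleteSpace E]
    (z : SymTensor 𝕜 n E), nrm E z = 0 → z = 0
  eps_le : ∀ (E : Type u) [NormedAddCommGroup E] [NormedSpace 𝕜 E] [CompleteSpace E]
    (z : SymTensor 𝕜 n E), epsNorm z ≤ nrm E z
  le_pi : ∀ (E : Type u) [NormedAddCommGroup E] [NormedSpace 𝕜 E] [CompleteSpace E]
    (z : SymTensor 𝕜 n E), nrm E z ≤ piNorm z
  map_le : ∀ (E F : Type u) [NormedAddCommGroup E] [NormedSpace 𝕜 E] [CompleteSpace E]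
    [NormedAddCommGroup F] [NormedSpace 𝕜 F] [CompleteSpace F] (T : E →L[𝕜] F)
    (z : SymTensor 𝕜 n E), nrm F (SymTensor.map T z) ≤ ‖T‖ ^ n * nrm E z

namespace STensorNorm

variable {𝕜 n} (α : STensorNorm.{u} 𝕜 n)

/-- `α(z; ⊗^{n,s} E)` is the infimum of the `α(z; ⊗^{n,s} M)` over the finite dimensional
subspaces `M` of `E` with `z ∈ ⊗^{n,s} M`. -/
def IsFinitelyGenerated : Prop :=
  ∀ (E : Type u) [NormedAddCommGroup E] [NormedSpace 𝕜 E] [CompleteSpace E]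
    (z : SymTensor 𝕜 n E),
    IsGLB {r | ∃ (M : Submodule 𝕜 E) (_ : FiniteDimensional 𝕜 M) (w : SymTensor 𝕜 n M),
      SymTensor.map M.subtypeL w = z ∧ r = α.nrm M w} (α.nrm E z)

variable (E : Type u) [NormedAddCommGroup E] [NormedSpace 𝕜 E] [CompleteSpace E]

/-- The normed space `⊗_α^{n,s} E`. -/
def Space (_α : STensorNorm.{u} 𝕜 n) (E : Type u) [NormedAddCommGroup E] [NormedSpace 𝕜 E]
    [CompleteSpace E] : Type u :=
  SymTensor 𝕜 n E

instance : AddCommGroup (α.Space E) := inferInstanceAs (AddCommGroup (SymTensor 𝕜 n E))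

instance : Module 𝕜 (α.Space E) := inferInstanceAs (Module 𝕜 (SymTensor 𝕜 n E))

instance : NormedAddCommGroup (α.Space E) :=
  AddGroupNorm.toNormedAddCommGroup
    { toFun := fun z : SymTensor 𝕜 n E => α.nrm E z
      map_zero' := map_zero (α.nrm E)
      add_le' := map_add_le_add (α.nrm E)
      neg' := map_neg_eq_map (α.nrm E)
      eq_zero_of_map_eq_zero' := α.eq_zero E }

instance : NormedSpace 𝕜 (α.Space E) where
  norm_smul_le c z := (map_smul_eq_mul (α.nrm E) c z).le

/-- The Banach space `⊗̃_α^{n,s} E`, the completion of `⊗_α^{n,s} E`. -/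
abbrev Compl : Type u := UniformSpace.Completion (α.Space E)

variable {E}

/-- A symmetric tensor as an element of the normed space `⊗_α^{n,s} E`. -/
def toSpace : SymTensor 𝕜 n E →ₗ[𝕜] α.Space E := LinearMap.id

theorem norm_toSpace (z : SymTensor 𝕜 n E) : ‖α.toSpace z‖ = α.nrm E z := rfl

/-- The power `⊗ⁿ x` as an element of `⊗̃_α^{n,s} E`. -/
def pow (x : E) : α.Compl E := (α.toSpace (symPow 𝕜 n x) : α.Space E)

/-- The functional `φ ∈ (⊗̃_α^{n,s} E)'` is (the linearization of) the polynomial `P`. Such a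
`φ` is unique, since the powers span a dense subspace. -/
def Represents (φ : StrongDual 𝕜 (α.Compl E)) (P : E → 𝕜) : Prop :=
  ∀ x : E, φ (α.pow x) = P x

end STensorNorm

end Tensor

/-! ### Banach ideals of homogeneous polynomials -/

/-- A Banach ideal of continuous scalar valued `n`-homogeneous polynomials. -/
structure PolyIdeal (𝕜 : Type) [RCLike 𝕜] (n : ℕ) where
  /-- the component `𝒬(E)` -/
  carrier : ∀ (E : Type u) [NormedAddCommGroup E] [NormedSpace 𝕜 E] [CompleteSpace E],
    Submodule 𝕜 (E → 𝕜)
  le_homPoly : ∀ (E : Type u) [NormedAddCommGroup E] [NormedSpace 𝕜 E] [CompleteSpace E],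
    carrier E ≤ HomPoly 𝕜 n E
  /-- the norm `‖·‖_{𝒬(E)}` -/
  nrm : ∀ (E : Type u) [NormedAddCommGroup E] [NormedSpace 𝕜 E] [CompleteSpace E],
    Seminorm 𝕜 (carrier E)
  eq_zero : ∀ (E : Type u) [NormedAddCommGroup E] [NormedSpace 𝕜 E] [CompleteSpace E]
    (P : carrier E), nrm E P = 0 → P = 0
  /-- `𝒬(E)` is complete: Cauchy sequences converge -/
  complete : ∀ (E : Type u) [NormedAddCommGroup E] [NormedSpace 𝕜 E] [CompleteSpace E]
    (p : ℕ → carrier E),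
    (∀ ε : ℝ, 0 < ε → ∃ N, ∀ k ≥ N, ∀ l ≥ N, nrm E (p k - p l) < ε) →
      ∃ P : carrier E, Tendsto (fun k => nrm E (p k - P)) atTop (𝓝 0)
  comp_mem : ∀ (E₁ E : Type u) [NormedAddCommGroup E₁] [NormedSpace 𝕜 E₁] [CompleteSpace E₁]
    [NormedAddCommGroup E] [NormedSpace 𝕜 E] [CompleteSpace E] (T : E₁ →L[𝕜] E)
    (P : E → 𝕜), P ∈ carrier E → P ∘ T ∈ carrier E₁
  nrm_comp_le : ∀ (E₁ E : Type u) [NormedAddCommGroup E₁] [NormedSpace 𝕜 E₁] [CompleteSpace E₁]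
    [NormedAddCommGroup E] [NormedSpace 𝕜 E] [CompleteSpace E] (T : E₁ →L[𝕜] E)
    (P : E → 𝕜) (hP : P ∈ carrier E),
    nrm E₁ ⟨P ∘ T, comp_mem E₁ E T P hP⟩ ≤ nrm E ⟨P, hP⟩ * ‖T‖ ^ n
  /-- the polynomial `z ↦ zⁿ` on the scalar field (lifted to the universe of the spaces) -/
  pow_mem : (fun z : ULift.{u} 𝕜 => z.down ^ n) ∈ carrier (ULift.{u} 𝕜)
  nrm_pow : nrm (ULift.{u} 𝕜) ⟨fun z : ULift.{u} 𝕜 => z.down ^ n, pow_mem⟩ = 1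

namespace PolyIdeal

variable {𝕜 : Type} [RCLike 𝕜] {n : ℕ} (Q : PolyIdeal.{u} 𝕜 n)
variable {E : Type u} [NormedAddCommGroup E] [NormedSpace 𝕜 E] [CompleteSpace E]

open Classical in
/-- The ideal norm with value `∞` outside of `𝒬(E)`. -/
def extNrm (P : E → 𝕜) : ℝ≥0∞ :=
  if h : P ∈ Q.carrier E then ENNReal.ofReal (Q.nrm E ⟨P, h⟩) else ⊤

/-- `‖P‖_{𝒬^max(E)} = sup {‖P|_M‖_{𝒬(M)} : M ∈ FIN(E)} ∈ [0, ∞]`. -/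
def maxNrm (P : E → 𝕜) : ℝ≥0∞ :=
  ⨆ (M : Submodule 𝕜 E) (_ : FiniteDimensional 𝕜 M), Q.extNrm (P ∘ M.subtypeL)

/-- The ideal coincides with its maximal kernel, with equal norms. -/
def IsMaximal : Prop :=
  ∀ (E : Type u) [NormedAddCommGroup E] [NormedSpace 𝕜 E] [CompleteSpace E],
    ∀ P ∈ HomPoly 𝕜 n E, (P ∈ Q.carrier E ↔ Q.maxNrm P < ⊤) ∧
      ∀ hP : P ∈ Q.carrier E, ENNReal.ofReal (Q.nrm E ⟨P, hP⟩) = Q.maxNrm P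

end PolyIdeal

end PolyExt

end

noncomputable section

/-! One inequality is soft: composing `P̄` with the canonical embedding of `E` into its ultrapower,
which has norm at most `1`, gives back `P`.

For the other, finite generation and maximality reduce the claim to finite dimensional subspaces `M`
of the ultrapower. On `M` a linear choice of representatives yields operators `T i : M → E`, of norm
at most `r > 1`, whose classes recover the elements of `M`. A single `P ∘ T i` is not enough: its
limit is `lim_i A (z_i, …, z_i)` and not the iterated limit. Averaging repairs this. Expand `P` at
`m⁻¹ (T i₁ x + ⋯ + T iₘ x)` by multilinearity and take the iterated limit over `i₁, …, iₘ`. By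
symmetry of `A`, each term with `n` distinct indices gives exactly `P̄ x`, and the proportion of the
other terms tends to `0` as `m → ∞`. The averages still have norm at most `r`, so `P̄` on `M` is a
pointwise limit of polynomials `P ∘ S` with `‖S‖ ≤ r` (`iterExt_restrict_mem_closure`).

It remains to see that the bounds survive pointwise limits and to let `r → 1`. In (a) a tensor
involves only finitely many point evaluations; in (b) the ball of the finite dimensional space
`𝒬(M)` is compact. -/

namespace PolyExt

/-! ### Iterated limits as limits along one ultrafilter -/

section IteratedUltrafilter

variable {𝕜 : Type} [RCLike 𝕜] {I : Type u} (U : Ultrafilter I)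

/-- The `n`-fold iterated product of the ultrafilter `U`: a set `s` belongs to it if and only if
`∀ᶠ i₁ in U, …, ∀ᶠ iₙ in U, (i₁, …, iₙ) ∈ s`. -/
def iterUltrafilter : (n : ℕ) → Ultrafilter (Fin n → I)
  | 0 => pure Fin.elim0
  | n + 1 => U.bind fun i => (iterUltrafilter n).map (Fin.cons i)

theorem eventually_iterUltrafilter_succ {n : ℕ} {p : (Fin (n + 1) → I) → Prop} :
    (∀ᶠ k in iterUltrafilter U (n + 1), p k) ↔
      ∀ᶠ i in U, ∀ᶠ k in iterUltrafilter U n, p (Fin.cons i k) :=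
  Iff.rfl

theorem tendsto_eval_iterUltrafilter {n : ℕ} (j : Fin n) :
    Tendsto (fun k : Fin n → I => k j) (iterUltrafilter U n) U := by
  induction n with
  | zero => exact j.elim0
  | succ n ih =>
    intro s hs
    rw [mem_map]
    change ∀ᶠ k : Fin (n + 1) → I in iterUltrafilter U (n + 1), k j ∈ s
    rw [eventually_iterUltrafilter_succ]
    refine Fin.cases ?_ (fun j => ?_) j
    · filter_upwards [hs] with i hi
      simpa using hi
    · exact Eventually.of_forall fun i => by simp only [Fin.cons_succ]; exact ih j hs

/-- The iterated limit of a bounded family is its limit along the iterated ultrafilter. -/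
theorem tendsto_iterUltrafilter {n : ℕ} (f : (Fin n → I) → 𝕜) (C : ℝ) (hf : ∀ k, ‖f k‖ ≤ C) :
    Tendsto f (iterUltrafilter U n) (𝓝 (iterLim U n f)) := by
  -- Membership in a closed set passes through one limit at a time, so it suits induction better
  -- than convergence. Closed balls around the limit along the iterated ultrafilter then identify
  -- the two limits.
  have key : ∀ (n : ℕ) (f : (Fin n → I) → 𝕜), (∀ k, ‖f k‖ ≤ C) → ∀ s : Set 𝕜, IsClosed s →
      (∀ᶠ k in iterUltrafilter U n, f k ∈ s) → iterLim U n f ∈ s := by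
    intro n
    induction n with
    | zero => exact fun f _ s _ h => h
    | succ n ih =>
      intro f hf s hs h
      refine hs.mem_of_tendsto (tendsto_iterLim U n f C hf) ?_
      filter_upwards [(eventually_iterUltrafilter_succ U).1 h] with i hi
      exact ih _ (fun _ => hf _) s hs hi
  have hL := tendsto_limUnder_of_bounded (iterUltrafilter U n) f C hf
  suffices h : iterLim U n f = limUnder (iterUltrafilter U n : Filter (Fin n → I)) f by rwa [h]
  refine eq_of_forall_dist_le fun ε hε => ?_
  exact key n f hf (Metric.closedBall _ ε) Metric.isClosed_closedBall
    (hL (Metric.closedBall_mem_nhds _ hε))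

theorem iterLim_const (n : ℕ) (c : 𝕜) : iterLim U n (fun _ => c) = c :=
  tendsto_nhds_unique (tendsto_iterUltrafilter U (fun _ : Fin n → I => c) ‖c‖ fun _ => le_rfl)
    tendsto_const_nhds

/-- An iterated limit that involves only some of the variables. -/
theorem iterLim_comp_strictMono {m n : ℕ} (s : Fin n → Fin m) (hs : StrictMono s)
    (f : (Fin n → I) → 𝕜) : iterLim U m (fun k => f (k ∘ s)) = iterLim U n f := by
  induction m generalizing n with
  | zero =>
    obtain rfl : n = 0 := by
      by_contra h
      exact (s ⟨0, Nat.pos_of_ne_zero h⟩).elim0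
    exact congrArg f (Subsingleton.elim _ _)
  | succ m ih =>
    by_cases h0 : ∃ j, s j = 0
    · obtain ⟨j, hj⟩ := h0
      obtain ⟨n, rfl⟩ : ∃ n', n = n' + 1 := ⟨n - 1, by have := j.2; omega⟩
      -- A strictly increasing `s` that attains `0` does so at `0`. Both sides then share their
      -- outermost limit, and the rest of `s` is a shifted increasing map `t`.
      have hs0 : s 0 = 0 := le_antisymm (hj ▸ hs.monotone (Fin.zero_le j)) (Fin.zero_le _)
      have hpos : ∀ j : Fin n, s j.succ ≠ 0 := fun j h =>
        absurd (hs (Fin.succ_pos j)) (by rw [hs0, h]; exact lt_irrefl _)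
      choose t ht using fun j => Fin.exists_succ_eq.2 (hpos j)
      have htm : StrictMono t := fun a b hab => by
        rw [← Fin.succ_lt_succ_iff, ht, ht]
        exact hs (Fin.succ_lt_succ_iff.2 hab)
      simp only [iterLim]
      congr 1
      funext i
      rw [← ih t htm]
      congr 1
      funext k
      congr 1
      funext j
      refine Fin.cases ?_ (fun j => ?_) j
      · simp [hs0]
      · simp [← ht]
    -- Here the outermost variable does not occur, so the outer limit is that of a constant family.
    · push Not at h0
      choose t ht using fun j => Fin.exists_succ_eq.2 (h0 j)
      have htm : StrictMono t := fun a b hab => by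
        rw [← Fin.succ_lt_succ_iff, ht, ht]
        exact hs hab
      have h1 : ∀ i : I, iterLim U m (fun k => f (Fin.cons i k ∘ s)) = iterLim U n f := by
        intro i
        rw [← ih t htm]
        congr 1
        funext k
        congr 1
        funext j
        simp [← ht]
      simp only [iterLim, h1]
      exact tendsto_const_nhds.limUnder_eq

end IteratedUltrafilter

/-! ### The extended multilinear form and its diagonal -/

section Multilinear

variable {𝕜 : Type} [RCLike 𝕜] {I : Type u} (U : Ultrafilter I) {n : ℕ}
variable {E : Type u} [NormedAddCommGroup E] [NormedSpace 𝕜 E]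

theorem norm_apply_family_le (A : ContinuousMultilinearMap 𝕜 (fun _ : Fin n => E) 𝕜)
    (w : Fin n → lp (fun _ : I => E) ∞) (k : Fin n → I) :
    ‖A fun j => w j (k j)‖ ≤ ‖A‖ * ∏ j, ‖w j‖ := by
  refine (A.le_opNorm _).trans ?_
  gcongr with j
  exact lp.norm_apply_le_norm (by simp) (w j) (k j)

/-- With a single limit in place of nested ones, multilinearity and norm bounds follow from limit
arithmetic and uniqueness of limits. -/
theorem tendsto_iterExtMultilinear (A : ContinuousMultilinearMap 𝕜 (fun _ : Fin n => E) 𝕜)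
    (w : Fin n → lp (fun _ : I => E) ∞) :
    Tendsto (fun k : Fin n → I => A fun j => w j (k j)) (iterUltrafilter U n)
      (𝓝 (iterExtMultilinear A fun j => Ultrapower.mk 𝕜 U (w j))) := by
  rw [iterExtMultilinear_mk]
  exact tendsto_iterUltrafilter U _ _ (norm_apply_family_le A w)

/-- Each coordinate projection sends the iterated ultrafilter to `U`, so the norms of the
representatives converge to the `‖z j‖` and the pointwise bound passes to the limit. -/
theorem norm_iterExtMultilinear_le (A : ContinuousMultilinearMap 𝕜 (fun _ : Fin n => E) 𝕜)
    (z : Fin n → Ultrapower 𝕜 U E) : ‖iterExtMultilinear A z‖ ≤ ‖A‖ * ∏ j, ‖z j‖ := by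
  obtain ⟨w, rfl⟩ : ∃ w : Fin n → lp (fun _ : I => E) ∞, (fun j => Ultrapower.mk 𝕜 U (w j)) = z :=
    ⟨fun j => (z j).rep, funext fun j => Ultrapower.mk_rep _⟩
  refine le_of_tendsto_of_tendsto' (tendsto_iterExtMultilinear U A w).norm
    ((tendsto_finsetProd (f := fun j (k : Fin n → I) => ‖w j (k j)‖) Finset.univ fun j _ =>
      (Ultrapower.tendsto_norm (𝕜 := 𝕜) (w j)).comp
        (tendsto_eval_iterUltrafilter U j)).const_mul ‖A‖) fun k => A.le_opNorm _

theorem update_mk [DecidableEq (Fin n)] (w : Fin n → lp (fun _ : I => E) ∞) (j : Fin n)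
    (x : lp (fun _ : I => E) ∞) :
    Function.update (fun l => Ultrapower.mk 𝕜 U (w l)) j (Ultrapower.mk 𝕜 U x) =
      fun l => Ultrapower.mk 𝕜 U (Function.update w j x l) := by
  funext l
  by_cases h : l = j
  · subst h; simp
  · simp [h]

theorem update_family_apply [DecidableEq (Fin n)] (w : Fin n → lp (fun _ : I => E) ∞) (j : Fin n)
    (x : lp (fun _ : I => E) ∞) (k : Fin n → I) :
    (fun l => (Function.update w j x l : I → E) (k l)) =
      Function.update (fun l => w l (k l)) j (x (k j)) := by
  funext l
  by_cases h : l = j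
  · subst h; simp
  · simp [h]

/-- The iterated extension of a continuous multilinear form to the ultrapower, as a continuous
multilinear form. -/
def iterExtCMM (A : ContinuousMultilinearMap 𝕜 (fun _ : Fin n => E) 𝕜) :
    ContinuousMultilinearMap 𝕜 (fun _ : Fin n => Ultrapower 𝕜 U E) 𝕜 :=
  MultilinearMap.mkContinuous
    { toFun := iterExtMultilinear A
      map_update_add' := by
        intro _ z j x y
        obtain ⟨w, rfl⟩ : ∃ w : Fin n → lp (fun _ : I => E) ∞,
          (fun j => Ultrapower.mk 𝕜 U (w j)) = z :=
          ⟨fun j => (z j).rep, funext fun j => Ultrapower.mk_rep _⟩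
        obtain ⟨x, rfl⟩ := Ultrapower.mk_surjective x
        obtain ⟨y, rfl⟩ := Ultrapower.mk_surjective y
        simp only [← map_add, update_mk]
        refine tendsto_nhds_unique (tendsto_iterExtMultilinear U A _)
          (((tendsto_iterExtMultilinear U A _).add (tendsto_iterExtMultilinear U A _)).congr
            fun k => ?_)
        simp only [update_family_apply, lp.coeFn_add, Pi.add_apply, A.map_update_add]
      map_update_smul' := by
        intro _ z j c x
        obtain ⟨w, rfl⟩ : ∃ w : Fin n → lp (fun _ : I => E) ∞,
          (fun j => Ultrapower.mk 𝕜 U (w j)) = z :=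
          ⟨fun j => (z j).rep, funext fun j => Ultrapower.mk_rep _⟩
        obtain ⟨x, rfl⟩ := Ultrapower.mk_surjective x
        simp only [← map_smul, update_mk]
        refine tendsto_nhds_unique (tendsto_iterExtMultilinear U A _)
          (((tendsto_iterExtMultilinear U A _).const_smul c).congr fun k => ?_)
        simp only [update_family_apply, lp.coeFn_smul, Pi.smul_apply, A.map_update_smul] }
    ‖A‖ (norm_iterExtMultilinear_le U A)

/-- The diagonal of a continuous multilinear form, symmetric or not, is a continuous homogeneous
polynomial. -/
theorem diag_mem_homPoly (A : ContinuousMultilinearMap 𝕜 (fun _ : Fin n => E) 𝕜) :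
    (fun x => A fun _ => x) ∈ HomPoly 𝕜 n E := by
  -- Symmetrization leaves the diagonal unchanged. It is needed because iterated limits along `U`
  -- need not commute, so the extended form need not be symmetric.
  refine ⟨((n.factorial : 𝕜)⁻¹) • ∑ σ : Equiv.Perm (Fin n), A.domDomCongr σ, fun τ v => ?_,
    fun x => ?_⟩
  · simp only [smul_apply, sum_apply,
      ContinuousMultilinearMap.domDomCongr_apply]
    congr 1
    exact Equiv.sum_comp (Equiv.mulLeft τ) fun σ : Equiv.Perm (Fin n) => A fun i => v (σ i)
  · simp [Finset.card_univ, Fintype.card_perm,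
      Nat.factorial_ne_zero]

theorem iterExt_mem_homPoly (P : HomPoly 𝕜 n E) :
    iterExt U P ∈ HomPoly 𝕜 n (Ultrapower 𝕜 U E) :=
  diag_mem_homPoly (iterExtCMM U (HomPoly.assoc P))

end Multilinear

/-! ### The canonical embedding into the ultrapower -/

section Embedding

variable (𝕜 : Type) [RCLike 𝕜] {I : Type u} (U : Ultrafilter I) {n : ℕ}
variable (E : Type u) [NormedAddCommGroup E] [NormedSpace 𝕜 E]

/-- The constant family `(x)_{i ∈ I}`. -/
def constFamily (x : E) : lp (fun _ : I => E) ∞ :=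
  ⟨fun _ => x, memℓp_infty ⟨‖x‖, by rintro _ ⟨_, rfl⟩; exact le_rfl⟩⟩

/-- The canonical embedding of `E` into its ultrapower. -/
def canonicalEmbedding : E →L[𝕜] Ultrapower 𝕜 U E :=
  LinearMap.mkContinuous
    { toFun := fun x => Ultrapower.mk 𝕜 U (constFamily E x)
      map_add' := fun x y => by rw [← map_add]; rfl
      map_smul' := fun c x => by rw [RingHom.id_apply, ← map_smul]; rfl }
    1 fun x => by
      rw [one_mul]
      exact le_of_tendsto' (Ultrapower.tendsto_norm (𝕜 := 𝕜) (U := U) (constFamily E x))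
        fun _ => le_rfl

theorem norm_canonicalEmbedding_le : ‖canonicalEmbedding 𝕜 U E‖ ≤ 1 :=
  LinearMap.mkContinuous_norm_le _ zero_le_one _

variable {𝕜 E}

theorem iterExt_canonicalEmbedding (P : HomPoly 𝕜 n E) (x : E) :
    iterExt U P (canonicalEmbedding 𝕜 U E x) = P.1 x := by
  rw [HomPoly.assoc_diag P]
  exact (iterExtMultilinear_mk (HomPoly.assoc P) fun _ => constFamily E x).trans
    (iterLim_const U n (HomPoly.assoc P fun _ => x))

end Embedding

/-! ### Approximating the extension on finite dimensional subspaces -/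

section Approximation

variable {𝕜 : Type} [RCLike 𝕜] {I : Type u} (U : Ultrafilter I) {n : ℕ}
variable {E : Type u} [NormedAddCommGroup E] [NormedSpace 𝕜 E]

/-- A finite dimensional subspace `M` of the ultrapower is the limit of operators `T i : M → E`
with norms arbitrarily close to `1`. -/
theorem exists_approximating_operators (M : Submodule 𝕜 (Ultrapower 𝕜 U E))
    [FiniteDimensional 𝕜 M] {r : ℝ} (hr : 1 < r) :
    ∃ T : I → M →L[𝕜] E, (∀ i, ‖T i‖ ≤ r) ∧
      ∀ x : M, ∃ w : lp (fun _ : I => E) ∞, (∀ i, w i = T i x) ∧ Ultrapower.mk 𝕜 U w = x := by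
  classical
  -- An algebraic section of the quotient map suffices: its restriction to `M` is continuous by
  -- finite dimension. The crude bound `‖G‖` is improved to `r` for `U`-almost all `i` by a net
  -- argument.
  obtain ⟨g, hg⟩ := (Ultrapower.mk 𝕜 U : lp (fun _ : I => E) ∞ →ₗ[𝕜] _)
    |>.exists_rightInverse_of_surjective (LinearMap.range_eq_top.2 Ultrapower.mk_surjective)
  let G : M →L[𝕜] lp (fun _ : I => E) ∞ := LinearMap.toContinuousLinearMap (g ∘ₗ M.subtype)
  have hG : ∀ x, Ultrapower.mk 𝕜 U (G x) = x := fun x =>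
    LinearMap.congr_fun hg (x : Ultrapower 𝕜 U E)
  have hGle : ∀ i x, ‖G x i‖ ≤ ‖G‖ * ‖x‖ := fun i x =>
    (lp.norm_apply_le_norm (by simp) (G x) i).trans (G.le_opNorm x)
  let T : I → M →L[𝕜] E := fun i => LinearMap.mkContinuous
    { toFun := fun x => G x i
      map_add' := fun x y => by simp
      map_smul' := fun c x => by simp } ‖G‖ (hGle i)
  have hT : ∀ i x, T i x = G x i := fun i x => rfl
  have hev : ∀ᶠ i in U, ‖T i‖ ≤ r := by
    have hC : 0 < 1 + ‖G‖ := by positivity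
    -- Solves `1 + δ + ‖G‖ δ = r`: at points of a finite `δ`-net of the unit ball `‖T i y‖ < 1 + δ`
    -- eventually, and moving off the net costs at most `‖G‖ δ`.
    set δ : ℝ := (r - 1) / (1 + ‖G‖) with hδ
    have hδ0 : 0 < δ := div_pos (by linarith) hC
    have hδr : 1 + δ + ‖G‖ * δ = r := by rw [hδ]; field_simp; ring
    have : ProperSpace M := FiniteDimensional.proper 𝕜 M
    obtain ⟨t, ht, htf, hcov⟩ :=
      (isCompact_closedBall (0 : M) 1).finite_cover_balls hδ0
    have h1 : ∀ᶠ i in U, ∀ y ∈ t, ‖T i y‖ < 1 + δ := by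
      rw [eventually_all_finite htf]
      intro y hy
      have h2 := Ultrapower.tendsto_norm (𝕜 := 𝕜) (U := U) (G y)
      rw [hG y] at h2
      have h3 : ‖(y : Ultrapower 𝕜 U E)‖ ≤ 1 := by simpa using ht hy
      exact h2.eventually_lt_const (by linarith)
    filter_upwards [h1] with i hi
    refine ContinuousLinearMap.opNorm_le_of_unit_norm (by linarith) fun x hx => ?_
    obtain ⟨y, hy, hxy⟩ := Set.mem_iUnion₂.1 (hcov (show x ∈ Metric.closedBall (0 : M) 1 by
      simp [hx]))
    rw [Metric.mem_ball, dist_eq_norm] at hxy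
    calc ‖T i x‖ = ‖T i y + T i (x - y)‖ := by rw [map_sub]; congr 1; abel
      _ ≤ ‖T i y‖ + ‖T i (x - y)‖ := norm_add_le _ _
      _ ≤ (1 + δ) + ‖G‖ * δ := by
        gcongr
        · exact (hi y hy).le
        · exact (hGle i (x - y)).trans (by gcongr)
      _ = r := hδr
  -- Setting the exceptional operators to `0` makes the bound hold for every `i`, and changes no
  -- class in the ultrapower.
  refine ⟨fun i => if ‖T i‖ ≤ r then T i else 0, fun i => ?_, fun x => ?_⟩
  · dsimp only
    split_ifs with h
    · exact h
    · rw [norm_zero]; linarith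
  · have hw : Memℓp (fun i => (if ‖T i‖ ≤ r then T i else 0) x) ∞ := by
      refine memℓp_infty ⟨‖G‖ * ‖x‖, ?_⟩
      rintro _ ⟨i, rfl⟩
      dsimp only
      split_ifs with h
      · exact hGle i x
      · simp only [zero_apply, norm_zero]; positivity
    refine ⟨⟨_, hw⟩, fun i => rfl, ?_⟩
    refine Eq.trans ?_ (hG x)
    rw [Ultrapower.mk_eq_mk_iff]
    refine tendsto_const_nhds.congr' ?_
    filter_upwards [hev] with i hi
    simp [hi, hT]

/-- The proportion of non-injective maps `Fin n → Fin m` tends to `0` as `m → ∞`. -/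
theorem tendsto_card_not_injective (n : ℕ) :
    Tendsto (fun m : ℕ => ((m : ℝ)⁻¹) ^ n *
      ((Finset.univ.filter fun s : Fin n → Fin m => ¬ Function.Injective s).card : ℝ))
      atTop (𝓝 0) := by
  have h1 : Tendsto (fun m : ℕ => (m.descFactorial n : ℝ) / (m : ℝ) ^ n) atTop (𝓝 1) := by
    refine (Asymptotics.isEquivalent_iff_tendsto_one ?_).1 (isEquivalent_descFactorial n)
    filter_upwards [eventually_gt_atTop 0] with m hm
    positivity
  have h2 := h1.const_sub 1
  rw [sub_self] at h2
  refine h2.congr' ?_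
  filter_upwards [eventually_gt_atTop 0] with m hm
  have hc : ((Finset.univ.filter fun s : Fin n → Fin m => Function.Injective s).card : ℕ) =
      m.descFactorial n := by
    rw [← Fintype.card_subtype,
      Fintype.card_congr (Equiv.subtypeInjectiveEquivEmbedding (Fin n) (Fin m)),
      Fintype.card_embedding_eq, Fintype.card_fin, Fintype.card_fin]
  have ht := Finset.card_filter_add_card_filter_not (s := (Finset.univ : Finset (Fin n → Fin m)))
    (fun s : Fin n → Fin m => Function.Injective s)
  rw [hc, Finset.card_univ, Fintype.card_fun, Fintype.card_fin, Fintype.card_fin] at ht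
  have ht' : ((Finset.univ.filter fun s : Fin n → Fin m => ¬ Function.Injective s).card : ℝ) =
      (m : ℝ) ^ n - m.descFactorial n := by
    rw [eq_sub_iff_add_eq']
    exact_mod_cast ht
  rw [ht', inv_pow]
  have : (m : ℝ) ≠ 0 := by positivity
  field_simp

theorem norm_homPoly_le (P : HomPoly 𝕜 n E) (x : E) : ‖P.1 x‖ ≤ ‖HomPoly.assoc P‖ * ‖x‖ ^ n := by
  rw [HomPoly.assoc_diag]
  simpa using (HomPoly.assoc P).le_opNorm fun _ => x

/-- By symmetry of the form, the iterated limits of `A (z_{i_{s 1}}, …, z_{i_{s n}})` do not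
depend on the order of the different indices `s 1, …, s n`. -/
theorem iterLim_comp_injective (P : HomPoly 𝕜 n E) (w : lp (fun _ : I => E) ∞) {m : ℕ}
    (s : Fin n → Fin m) (hs : Function.Injective s) :
    iterLim U m (fun k => HomPoly.assoc P fun l => w (k (s l))) =
      iterExt U P (Ultrapower.mk 𝕜 U w) := by
  -- Sorting the indices makes them increasing, where `iterLim_comp_strictMono` applies; the
  -- symmetry of the form absorbs the sorting permutation.
  have hmono : StrictMono (s ∘ Tuple.sort s) :=
    (Tuple.monotone_sort s).strictMono_of_injective (hs.comp (Tuple.sort s).injective)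
  refine Eq.trans ?_ (iterExtMultilinear_mk (HomPoly.assoc P) fun _ => w).symm
  rw [← iterLim_comp_strictMono U (s ∘ Tuple.sort s) hmono]
  congr 1
  funext k
  exact (HomPoly.assoc_symm P (Tuple.sort s) fun l => w (k (s l))).symm

/-- The iterated extension is a pointwise limit of compositions of `P` with averages of the
operators `T i`. -/
theorem iterExt_comp_mem_closure (P : HomPoly 𝕜 n E) {N : Type*} [NormedAddCommGroup N]
    [NormedSpace 𝕜 N] (J : N → Ultrapower 𝕜 U E) (T : I → N →L[𝕜] E) {r : ℝ} (hr : 0 ≤ r)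
    (hT : ∀ i, ‖T i‖ ≤ r)
    (hJ : ∀ x : N, ∃ w : lp (fun _ : I => E) ∞, (∀ i, w i = T i x) ∧ Ultrapower.mk 𝕜 U w = J x) :
    iterExt U P ∘ J ∈ closure {f : N → 𝕜 | ∃ S : N →L[𝕜] E, ‖S‖ ≤ r ∧ f = P.1 ∘ S} := by
  let S : ∀ m : ℕ, (Fin m → I) → N →L[𝕜] E := fun m k => (m : 𝕜)⁻¹ • ∑ j, T (k j)
  have hS : ∀ m k, ‖S m k‖ ≤ r := by
    intro m k
    -- For `m = 0` the average is the zero operator.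
    rcases Nat.eq_zero_or_pos m with rfl | hm
    · simpa [S] using hr
    · have h1 : ‖∑ j, T (k j)‖ ≤ m * r := by
        refine (norm_sum_le_of_le Finset.univ fun j _ => hT (k j)).trans ?_
        simp
      calc ‖S m k‖ = (m : ℝ)⁻¹ * ‖∑ j, T (k j)‖ := by simp [S, norm_smul]
        _ ≤ (m : ℝ)⁻¹ * (m * r) := by gcongr
        _ = r := by field_simp
  let B : N → ℝ := fun x => ‖HomPoly.assoc P‖ * (r * ‖x‖) ^ n
  have hPS : ∀ m k x, ‖P.1 (S m k x)‖ ≤ B x := fun m k x => by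
    refine (norm_homPoly_le P _).trans ?_
    have := (S m k).le_of_opNorm_le (hS m k) x
    dsimp only [B]
    gcongr
  have hR : ∀ m, (fun x => iterLim U m fun k => P.1 (S m k x)) ∈
      closure {f : N → 𝕜 | ∃ S : N →L[𝕜] E, ‖S‖ ≤ r ∧ f = P.1 ∘ S} := by
    intro m
    refine isClosed_closure.mem_of_tendsto (b := (iterUltrafilter U m : Filter (Fin m → I)))
      (f := fun k => P.1 ∘ S m k)
      (tendsto_pi_nhds.2 fun x => tendsto_iterUltrafilter U _ (B x) fun k => hPS m k x)
      (Eventually.of_forall fun k => subset_closure ⟨S m k, hS m k, rfl⟩)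
  -- For fixed `m` the iterated limit already lies in the closure; now `m → ∞`.
  refine isClosed_closure.mem_of_tendsto (b := atTop) (tendsto_pi_nhds.2 fun x => ?_)
    (Eventually.of_forall hR)
  obtain ⟨w, hw, hwx⟩ := hJ x
  have hA : ∀ {m : ℕ} (s : Fin n → Fin m) (k : Fin m → I),
      ‖HomPoly.assoc P fun l => w (k (s l))‖ ≤ B x := by
    intro m s k
    refine ((HomPoly.assoc P).le_opNorm _).trans ?_
    have : ∀ l, ‖w (k (s l))‖ ≤ r * ‖x‖ := fun l => by
      rw [hw]
      exact (T _).le_of_opNorm_le (hT _) x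
    have h2 := Finset.prod_le_prod (s := Finset.univ) (fun l _ => norm_nonneg (w (k (s l))))
      (fun l _ => this l)
    rw [Finset.prod_const, Finset.card_univ, Fintype.card_fin] at h2
    dsimp only [B]
    gcongr
  -- Multilinear expansion of `P` at the average: `s` records which summand enters each slot.
  have hexp : ∀ m, (iterLim U m fun k => P.1 (S m k x)) = ((m : 𝕜)⁻¹) ^ n *
      ∑ s : Fin n → Fin m, iterLim U m fun k => HomPoly.assoc P fun l => w (k (s l)) := by
    intro m
    refine tendsto_nhds_unique (tendsto_iterUltrafilter U _ (B x) fun k => hPS m k x)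
      (((tendsto_finsetSum Finset.univ fun s _ =>
        tendsto_iterUltrafilter U _ (B x) (hA s)).const_mul _).congr fun k => ?_)
    rw [HomPoly.assoc_diag]
    have : (fun _ : Fin n => S m k x) =
        fun _ : Fin n => (m : 𝕜)⁻¹ • ∑ j, w (k j) := by
      funext _
      simp [S, hw, sum_apply]
    rw [this, (HomPoly.assoc P).map_smul_univ (fun _ => (m : 𝕜)⁻¹) (fun _ => ∑ j, w (k j)),
      (HomPoly.assoc P).map_sum]
    simp
  have hp : ‖iterExt U P (J x)‖ ≤ B x := by
    rw [← hwx, ← iterLim_comp_injective U P w (id : Fin n → Fin n) Function.injective_id]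
    exact norm_iterLim_le U n _ _ (hA _)
  rw [tendsto_iff_norm_sub_tendsto_zero]
  have hlim := (tendsto_card_not_injective n).mul_const (2 * B x)
  rw [zero_mul] at hlim
  refine squeeze_zero' (Eventually.of_forall fun _ => norm_nonneg _) ?_ hlim
  filter_upwards [eventually_gt_atTop 0] with m hm
  have hm' : (m : 𝕜) ≠ 0 := Nat.cast_ne_zero.2 hm.ne'
  have hdiff : (iterLim U m fun k => P.1 (S m k x)) - (iterExt U P ∘ J) x = ((m : 𝕜)⁻¹) ^ n *
      ∑ s : Fin n → Fin m, ((iterLim U m fun k => HomPoly.assoc P fun l => w (k (s l))) -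
        iterExt U P (J x)) := by
    rw [hexp, Finset.sum_sub_distrib, mul_sub]
    congr 1
    simp
    field_simp
  rw [hdiff, norm_mul, norm_pow, norm_inv, RCLike.norm_natCast, mul_assoc]
  gcongr
  -- Injective `s` contribute `0`; every other term is at most `2 * B x`.
  rw [← Finset.sum_filter_add_sum_filter_not Finset.univ Function.Injective,
    Finset.sum_eq_zero fun s hs => ?_, zero_add]
  · refine (norm_sum_le_of_le _ fun s _ => (norm_sub_le _ _).trans
      (add_le_add (norm_iterLim_le U m _ _ (hA s)) hp)).trans ?_
    rw [Finset.sum_const, nsmul_eq_mul, two_mul]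
  · rw [iterLim_comp_injective U P w s (Finset.mem_filter.1 hs).2, hwx, sub_self]

/-- On a finite dimensional subspace, the iterated extension of `P` is a pointwise limit of
polynomials `P ∘ S`, where the operators `S` have norms arbitrarily close to `1`. -/
theorem iterExt_restrict_mem_closure (P : HomPoly 𝕜 n E) (M : Submodule 𝕜 (Ultrapower 𝕜 U E))
    [FiniteDimensional 𝕜 M] {r : ℝ} (hr : 1 < r) :
    iterExt U P ∘ M.subtypeL ∈ closure {f : M → 𝕜 | ∃ S : M →L[𝕜] E, ‖S‖ ≤ r ∧ f = P.1 ∘ S} := by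
  obtain ⟨T, hT, hw⟩ := exists_approximating_operators U M hr
  exact iterExt_comp_mem_closure U P M.subtypeL T (by linarith) hT hw

end Approximation

/-! ### Part (a): s-tensor norms -/

section TensorNorm

variable {𝕜 : Type} [RCLike 𝕜] {I : Type u} (U : Ultrafilter I) {n : ℕ}

section Space

variable {E : Type u} [NormedAddCommGroup E] [NormedSpace 𝕜 E]

theorem SymTensor.map_symPow {F : Type u} [NormedAddCommGroup F] [NormedSpace 𝕜 F] (T : E →L[𝕜] F)
    (x : E) : SymTensor.map T (symPow 𝕜 n x) = symPow 𝕜 n (T x) :=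
  Subtype.ext (PiTensorProduct.map_tprod _ _)

theorem span_range_symPow :
    Submodule.span 𝕜 (Set.range (symPow 𝕜 n : E → SymTensor 𝕜 n E)) = ⊤ := by
  refine Submodule.map_injective_of_injective (SymTensor 𝕜 n E).injective_subtype ?_
  rw [Submodule.map_span, ← Set.range_comp, Submodule.map_top, Submodule.range_subtype]
  rfl

/-- Linear maps on `⊗^{n,s} E` that agree on the powers `⊗ⁿ x` are equal. -/
theorem SymTensor.hom_ext {V : Type*} [AddCommGroup V] [Module 𝕜 V]
    {f g : SymTensor 𝕜 n E →ₗ[𝕜] V} (h : ∀ x, f (symPow 𝕜 n x) = g (symPow 𝕜 n x)) : f = g :=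
  LinearMap.ext_on_range span_range_symPow h

theorem SymTensor.exists_eq_sum (z : SymTensor 𝕜 n E) :
    ∃ c : E →₀ 𝕜, z = c.sum fun x a => a • symPow 𝕜 n x := by
  have hz : z ∈ Submodule.span 𝕜 (Set.range (symPow 𝕜 n : E → SymTensor 𝕜 n E)) := by
    rw [span_range_symPow]; trivial
  obtain ⟨c, hc⟩ := Finsupp.mem_span_range_iff_exists_finsupp.1 hz
  exact ⟨c, hc.symm⟩

/-- The linearization of the diagonal of a multilinear form. -/
def linearization (A : ContinuousMultilinearMap 𝕜 (fun _ : Fin n => E) 𝕜) :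
    SymTensor 𝕜 n E →ₗ[𝕜] 𝕜 :=
  PiTensorProduct.lift A.toMultilinearMap ∘ₗ (SymTensor 𝕜 n E).subtype

theorem linearization_symPow (A : ContinuousMultilinearMap 𝕜 (fun _ : Fin n => E) 𝕜) (x : E) :
    linearization A (symPow 𝕜 n x) = A fun _ => x :=
  PiTensorProduct.lift.tprod _

end Space

namespace STensorNorm

variable (α : STensorNorm.{u} 𝕜 n)
variable {E : Type u} [NormedAddCommGroup E] [NormedSpace 𝕜 E] [CompleteSpace E]

/-- The restriction of a functional on `⊗̃_α^{n,s} E` to `⊗^{n,s} E`. -/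
def restrict (φ : StrongDual 𝕜 (α.Compl E)) : SymTensor 𝕜 n E →ₗ[𝕜] 𝕜 :=
  (φ.comp UniformSpace.Completion.toComplL).toLinearMap ∘ₗ α.toSpace

theorem restrict_apply (φ : StrongDual 𝕜 (α.Compl E)) (z : SymTensor 𝕜 n E) :
    α.restrict φ z = φ (α.toSpace z : α.Space E) := rfl

theorem norm_restrict_le (φ : StrongDual 𝕜 (α.Compl E)) (z : SymTensor 𝕜 n E) :
    ‖α.restrict φ z‖ ≤ ‖φ‖ * α.nrm E z := by
  rw [restrict_apply]
  refine (φ.le_opNorm _).trans_eq ?_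
  rw [UniformSpace.Completion.norm_coe, norm_toSpace]

theorem opNorm_le_of_restrict {φ : StrongDual 𝕜 (α.Compl E)} {C : ℝ} (hC : 0 ≤ C)
    (h : ∀ z, ‖α.restrict φ z‖ ≤ C * α.nrm E z) : ‖φ‖ ≤ C := by
  refine φ.opNorm_le_bound hC fun x => ?_
  induction x using UniformSpace.Completion.induction_on with
  | hp => exact isClosed_le (by fun_prop) (by fun_prop)
  | ih z =>
    rw [UniformSpace.Completion.norm_coe]
    exact h z

/-- A linear functional on `⊗^{n,s} E` that is bounded for `α` extends to the completion. -/
theorem exists_restrict_eq (L : SymTensor 𝕜 n E →ₗ[𝕜] 𝕜) (C : ℝ)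
    (h : ∀ z, ‖L z‖ ≤ C * α.nrm E z) : ∃ ψ : StrongDual 𝕜 (α.Compl E), α.restrict ψ = L := by
  let L' : α.Space E →L[𝕜] 𝕜 :=
    LinearMap.mkContinuous (show α.Space E →ₗ[𝕜] 𝕜 from L) C h
  refine ⟨L'.extend UniformSpace.Completion.toComplL, LinearMap.ext fun z => ?_⟩
  exact ContinuousLinearMap.extend_eq L' (UniformSpace.Completion.denseRange_coe)
    (UniformSpace.Completion.isUniformInducing_coe _) _

theorem restrict_symPow {φ : StrongDual 𝕜 (α.Compl E)} {P : E → 𝕜} (h : α.Represents φ P) (x : E) :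
    α.restrict φ (symPow 𝕜 n x) = P x := h x

/-- The linearization of the iterated extension is bounded by the norm of the functional. -/
theorem norm_linearization_iterExtCMM_le (hα : α.IsFinitelyGenerated) (P : HomPoly 𝕜 n E)
    (φ : StrongDual 𝕜 (α.Compl E)) (hφ : α.Represents φ P.1)
    (z : SymTensor 𝕜 n (Ultrapower 𝕜 U E)) :
    ‖linearization (iterExtCMM U (HomPoly.assoc P)) z‖ ≤
      ‖φ‖ * α.nrm (Ultrapower 𝕜 U E) z := by
  have hM : ∀ (M : Submodule 𝕜 (Ultrapower 𝕜 U E)) [FiniteDimensional 𝕜 M]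
      (w : SymTensor 𝕜 n M) (r : ℝ), 1 < r →
      ‖linearization (iterExtCMM U (HomPoly.assoc P)) (SymTensor.map M.subtypeL w)‖ ≤
        ‖φ‖ * (r ^ n * α.nrm M w) := by
    intro M _ w r hr
    obtain ⟨c, hc⟩ := SymTensor.exists_eq_sum w
    -- Pairing with the fixed tensor `w` uses only finitely many values of `f`, hence is continuous
    -- for pointwise convergence.
    let ev : (M → 𝕜) → 𝕜 := fun f => c.sum fun x a => a * f x
    have hev : Continuous ev := by
      dsimp only [ev, Finsupp.sum]
      fun_prop
    have h1 : linearization (iterExtCMM U (HomPoly.assoc P)) (SymTensor.map M.subtypeL w) =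
        ev (iterExt U P ∘ M.subtypeL) := by
      rw [hc]
      simp only [Finsupp.sum, map_sum, map_smul, SymTensor.map_symPow, linearization_symPow, ev,
        smul_eq_mul]
      rfl
    rw [h1]
    have hcl : IsClosed {f : M → 𝕜 | ‖ev f‖ ≤ ‖φ‖ * (r ^ n * α.nrm M w)} :=
      isClosed_le hev.norm continuous_const
    refine closure_minimal ?_ hcl (iterExt_restrict_mem_closure U P M hr)
    rintro _ ⟨S, hS, rfl⟩
    have h2 : ev (P.1 ∘ S) = α.restrict φ (SymTensor.map S w) := by
      rw [hc]
      simp only [Finsupp.sum, map_sum, map_smul, SymTensor.map_symPow, α.restrict_symPow hφ, ev,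
        smul_eq_mul, Function.comp_apply]
    rw [Set.mem_ofPred_eq, h2]
    refine (α.norm_restrict_le φ _).trans ?_
    gcongr
    refine (α.map_le M E S w).trans ?_
    have := apply_nonneg (α.nrm M) w
    gcongr
  have hM1 : ∀ (M : Submodule 𝕜 (Ultrapower 𝕜 U E)) [FiniteDimensional 𝕜 M]
      (w : SymTensor 𝕜 n M),
      ‖linearization (iterExtCMM U (HomPoly.assoc P)) (SymTensor.map M.subtypeL w)‖ ≤
        ‖φ‖ * α.nrm M w := by
    intro M _ w
    have hlim : Tendsto (fun r : ℝ => ‖φ‖ * (r ^ n * α.nrm M w)) (𝓝[>] 1)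
        (𝓝 (‖φ‖ * (1 ^ n * α.nrm M w))) :=
      (Continuous.tendsto (by fun_prop) 1).mono_left nhdsWithin_le_nhds
    rw [one_pow, one_mul] at hlim
    exact ge_of_tendsto hlim (eventually_mem_nhdsWithin.mono fun r hr => hM M w r hr)
  -- For `‖φ‖ > 0`, dividing by it gives a lower bound for the set whose infimum is `α(z)`. For `‖φ‖
  -- = 0`, a single representation of `z` in some `M` already forces the value `0`.
  rcases (norm_nonneg φ).eq_or_lt with h0 | hpos
  · obtain ⟨_, M, hMf, w, rfl, -⟩ := (hα (Ultrapower 𝕜 U E) z).nonempty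
    simpa [← h0] using hM1 M w
  · rw [← div_le_iff₀' hpos]
    refine (hα (Ultrapower 𝕜 U E) z).2 ?_
    rintro _ ⟨M, hMf, w, rfl, rfl⟩
    rw [div_le_iff₀' hpos]
    exact hM1 M w

theorem exists_represents_iterExt (hα : α.IsFinitelyGenerated) (P : HomPoly 𝕜 n E)
    (φ : StrongDual 𝕜 (α.Compl E)) (hφ : α.Represents φ P.1) :
    ∃ ψ : StrongDual 𝕜 (α.Compl (Ultrapower 𝕜 U E)),
      α.Represents ψ (iterExt U P) ∧ ‖φ‖ = ‖ψ‖ := by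
  have hL := α.norm_linearization_iterExtCMM_le U hα P φ hφ
  obtain ⟨ψ, hψ⟩ := α.exists_restrict_eq _ _ hL
  have hrep : ∀ x, α.restrict ψ (symPow 𝕜 n x) = iterExt U P x := fun x => by
    rw [hψ, linearization_symPow]
    rfl
  refine ⟨ψ, hrep, le_antisymm ?_ ?_⟩
  · have hcomp : α.restrict φ = α.restrict ψ ∘ₗ SymTensor.map (canonicalEmbedding 𝕜 U E) :=
      SymTensor.hom_ext fun x => by
        rw [α.restrict_symPow hφ, LinearMap.comp_apply, SymTensor.map_symPow, hrep,
          iterExt_canonicalEmbedding]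
    refine α.opNorm_le_of_restrict (norm_nonneg _) fun z => ?_
    rw [hcomp, LinearMap.comp_apply]
    refine (α.norm_restrict_le ψ _).trans ?_
    gcongr
    refine (α.map_le _ _ _ z).trans ?_
    exact mul_le_of_le_one_left (apply_nonneg _ _)
      (pow_le_one₀ (norm_nonneg _) (norm_canonicalEmbedding_le 𝕜 U E))
  · exact α.opNorm_le_of_restrict (norm_nonneg _) (by rw [hψ]; exact hL)

end STensorNorm

end TensorNorm

/-! ### Part (b): maximal ideals -/

section Ideal

variable {𝕜 : Type} [RCLike 𝕜] {n : ℕ}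

/-- The image of a closed ball of a finite dimensional normed space in a space of functions is
closed for pointwise convergence. -/
theorem isClosed_image_seminorm_ball {V : Type*} [AddCommGroup V] [Module 𝕜 V]
    [FiniteDimensional 𝕜 V] (p : Seminorm 𝕜 V) (hp : ∀ v, p v = 0 → v = 0) {X : Type*}
    (f : V →ₗ[𝕜] X → 𝕜) (C : ℝ) : IsClosed (Set.image f {v | p v ≤ C}) := by
  let _ : NormedAddCommGroup V := AddGroupNorm.toNormedAddCommGroup
    { toFun := p
      map_zero' := map_zero p
      add_le' := map_add_le_add p
      neg' := map_neg_eq_map p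
      eq_zero_of_map_eq_zero' := hp }
  let _ : NormedSpace 𝕜 V := ⟨fun c v => (map_smul_eq_mul p c v).le⟩
  have : ProperSpace V := FiniteDimensional.proper 𝕜 V
  have hball : {v | p v ≤ C} = Metric.closedBall (0 : V) C := by
    ext v
    rw [mem_closedBall_zero_iff]
    rfl
  rw [hball]
  -- The topology comes from `p`, and any linear map out of a finite dimensional space is
  -- continuous, so the image is compact.
  exact ((isCompact_closedBall (0 : V) C).image f.continuous_of_finiteDimensional).isClosed

theorem finiteDimensional_homPoly (M : Type u) [NormedAddCommGroup M] [NormedSpace 𝕜 M]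
    [FiniteDimensional 𝕜 M] : FiniteDimensional 𝕜 (HomPoly 𝕜 n M) := by
  let D : MultilinearMap 𝕜 (fun _ : Fin n => M) 𝕜 →ₗ[𝕜] M → 𝕜 :=
    { toFun := fun A x => A fun _ => x
      map_add' := fun A B => rfl
      map_smul' := fun c A => rfl }
  refine Submodule.finiteDimensional_of_le (S₂ := LinearMap.range D) ?_
  rintro P ⟨A, -, hA⟩
  exact ⟨A.toMultilinearMap, funext fun x => (hA x).symm⟩

namespace PolyIdeal

variable (Q : PolyIdeal.{u} 𝕜 n) {I : Type u} (U : Ultrafilter I)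
variable {E : Type u} [NormedAddCommGroup E] [NormedSpace 𝕜 E] [CompleteSpace E]

/-- Since `extNrm` is `⊤` off `𝒬(M)`, this sublevel set is the image of a ball of the finite
dimensional space `𝒬(M)`. Hence pointwise limits both stay in the ideal and keep the bound. -/
theorem isClosed_extNrm_le (M : Type u) [NormedAddCommGroup M] [NormedSpace 𝕜 M]
    [CompleteSpace M] [FiniteDimensional 𝕜 M] {C : ℝ} (hC : 0 ≤ C) :
    IsClosed {f : M → 𝕜 | Q.extNrm f ≤ ENNReal.ofReal C} := by
  have := finiteDimensional_homPoly (𝕜 := 𝕜) (n := n) M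
  have : FiniteDimensional 𝕜 (Q.carrier M) := Submodule.finiteDimensional_of_le (Q.le_homPoly M)
  convert isClosed_image_seminorm_ball (Q.nrm M) (Q.eq_zero M) (Q.carrier M).subtype C using 1
  ext f
  constructor
  · intro hf
    rw [Set.mem_ofPred_eq, extNrm] at hf
    split_ifs at hf with h
    · exact ⟨⟨f, h⟩, (ENNReal.ofReal_le_ofReal_iff hC).1 hf, rfl⟩
    · simp at hf
  · rintro ⟨g, hg, rfl⟩
    rw [Set.mem_ofPred_eq, Submodule.subtype_apply, extNrm, dif_pos g.2]
    exact ENNReal.ofReal_le_ofReal hg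

theorem maxNrm_iterExt_le (P : HomPoly 𝕜 n E) (hP : P.1 ∈ Q.carrier E) :
    Q.maxNrm (iterExt U P) ≤ ENNReal.ofReal (Q.nrm E ⟨P.1, hP⟩) := by
  refine iSup₂_le fun M hM => ?_
  have hr : ∀ r : ℝ, 1 < r → Q.extNrm (iterExt U P ∘ M.subtypeL) ≤
      ENNReal.ofReal (Q.nrm E ⟨P.1, hP⟩ * r ^ n) := by
    intro r hr
    have h0 := apply_nonneg (Q.nrm E) ⟨P.1, hP⟩
    refine closure_minimal ?_ (Q.isClosed_extNrm_le M (by positivity))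
      (iterExt_restrict_mem_closure U P M hr)
    rintro _ ⟨S, hS, rfl⟩
    rw [Set.mem_ofPred_eq, extNrm, dif_pos (Q.comp_mem M E S P.1 hP)]
    refine ENNReal.ofReal_le_ofReal ((Q.nrm_comp_le M E S P.1 hP).trans ?_)
    gcongr
  have hlim : Tendsto (fun r : ℝ => ENNReal.ofReal (Q.nrm E ⟨P.1, hP⟩ * r ^ n)) (𝓝[>] 1)
      (𝓝 (ENNReal.ofReal (Q.nrm E ⟨P.1, hP⟩ * 1 ^ n))) :=
    (Continuous.tendsto (ENNReal.continuous_ofReal.comp (by fun_prop)) 1).mono_left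
      nhdsWithin_le_nhds
  rw [one_pow, mul_one] at hlim
  exact ge_of_tendsto hlim (eventually_mem_nhdsWithin.mono fun r h => hr r h)

/-- Maximality turns the finite bound on `maxNrm` into membership and one inequality; the canonical
embedding gives the other. -/
theorem exists_iterExt_mem (hQ : Q.IsMaximal) (P : HomPoly 𝕜 n E) (hP : P.1 ∈ Q.carrier E) :
    ∃ h : iterExt U P ∈ Q.carrier (Ultrapower 𝕜 U E),
      Q.nrm E ⟨P.1, hP⟩ = Q.nrm (Ultrapower 𝕜 U E) ⟨iterExt U P, h⟩ := by
  have hle := Q.maxNrm_iterExt_le U P hP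
  obtain ⟨hmem, hnrm⟩ := hQ (Ultrapower 𝕜 U E) _ (iterExt_mem_homPoly U P)
  have h := hmem.2 (hle.trans_lt ENNReal.ofReal_lt_top)
  refine ⟨h, le_antisymm ?_ ?_⟩
  · have hcomp : iterExt U P ∘ canonicalEmbedding 𝕜 U E = P.1 :=
      funext fun x => iterExt_canonicalEmbedding U P x
    have h1 := Q.nrm_comp_le E (Ultrapower 𝕜 U E) (canonicalEmbedding 𝕜 U E) _ h
    simp only [hcomp] at h1
    exact h1.trans (mul_le_of_le_one_right (apply_nonneg _ _)
      (pow_le_one₀ (norm_nonneg _) (norm_canonicalEmbedding_le 𝕜 U E)))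
  · rw [← hnrm h] at hle
    exact (ENNReal.ofReal_le_ofReal_iff (apply_nonneg _ _)).1 hle

end PolyIdeal

end Ideal

end PolyExt

end

theorem theorem3p3 {𝕜 : Type} [RCLike 𝕜] (n : ℕ) {I : Type u} (U : Ultrafilter I)
    (E : Type u) [NormedAddCommGroup E] [NormedSpace 𝕜 E] [CompleteSpace E] :
    (∀ α : PolyExt.STensorNorm.{u} 𝕜 n, α.IsFinitelyGenerated →
      ∀ (P : PolyExt.HomPoly 𝕜 n E) (φ : StrongDual 𝕜 (α.Compl E)), α.Represents φ P.1 →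
        ∃ ψ : StrongDual 𝕜 (α.Compl (PolyExt.Ultrapower 𝕜 U E)),
          α.Represents ψ (PolyExt.iterExt U P) ∧ ‖φ‖ = ‖ψ‖) ∧
    (∀ Q : PolyExt.PolyIdeal.{u} 𝕜 n, Q.IsMaximal →
      ∀ (P : PolyExt.HomPoly 𝕜 n E) (hP : P.1 ∈ Q.carrier E),
        ∃ h : PolyExt.iterExt U P ∈ Q.carrier (PolyExt.Ultrapower 𝕜 U E),
          Q.nrm E ⟨P.1, hP⟩ =
            Q.nrm (PolyExt.Ultrapower 𝕜 U E) ⟨PolyExt.iterExt U P, h⟩) := by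
  exact ⟨fun α hα P φ hφ => α.exists_represents_iterExt U hα P φ hφ,
    fun Q hQ P hP => Q.exists_iterExt_mem U hQ P hP⟩
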